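/- Every presentable signature is representable. Here the notions are as follows. A monad $R=(R,\mu,\eta)$ is a monad on $\mathsf{Set}$, and $\mathsf{Mon}$ is the category of monads and monad morphisms. An $R$-module is a functor $M\colon\mathsf{Set}\to\mathsf{Set}$ with a natural transformation $\rho^M\colon M\cdot R\to M$ such that $\rho^M\circ\rho^M R=\rho^M\circ M\mu$ and $\rho^M\circ M\eta=1_M$. A morphism of $R$-modules is a natural transformation $\tau\colon M\to N$ with $\tau\circ\rho^M=\rho^N\circ\tau R$. Every monad $R$ is a module over itself, via $\mu$. For a monad morphism $f\colon R\to S$ and an $S$-module $N$, the pullback $f^*N$ is the $R$-module with underlying functor $N$ and substitution $\rho^N\circ Nf$. The category $\int\mathsf{Mod}$ has as objects the pairs $(R,M)$ of a monad and a module over it, and as morphisms $(R,M)\to(S,N)$ the pairs of a monad morphism $f\colon R\to S$ and a morphism of $R$-modules $M\to f^*N$. A *signature* is a section $\Sigma\colon R\mapsto (R,\Sigma(R))$ of the forgetful functor $\int\mathsf{Mod}\to\mathsf{Mon}$. A morphism of signatures is a natural transformation whose projection to $\mathsf{Mon}$ is the identity. The derivative of an $R$-module $M$ is $M'=M(-+*)$,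 with substitution $M(RX+*)\to M(R(X+*))\to M(X+*)$, whose first map is induced by $R(X\to X+*)$ on $RX$ and by the image under $\eta_{X+*}$ of the added point; the second map is $\rho^M_{X+*}$. Write $M^{(k)}$ for the $k$-th derivative. For a finite list $s=(s_1,\dots,s_n)$ of natural numbers (possibly empty), the *elementary signature* $\Theta^{(s)}$ is $R\mapsto R^{(s_1)}\times\cdots\times R^{(s_n)}$. An *algebraic signature* is a coproduct, in the category of signatures, of a (possibly infinite) family of elementary signatures indexed by a set. A signature $\Sigma$ is *presentable* if there are an algebraic signature $\Upsilon$ and an epimorphism of signatures $\Upsilon\to\Sigma$. A *model* of $\Sigma$ is a pair $(R,r)$ of a monad $R$ and a morphism of $R$-modules $r\colon\Sigma(R)\to R$. A morphism of models $(R,r)\to(S,s)$ is a monad morphism $m\colon R\to S$ with $m\circ r=s\circ\Sigma(m)$. The signature $\Sigma$ is *representable* if its category of models has an initial object. **Theorem.** Any presentable signature is representable. -/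

import Mathlib

open CategoryTheory

universe u

namespace ModSig

/-- A (left) module over a monad `R` on `Type u`: an endofunctor `M` with a module substitution
`ρ : M · R ⟶ M` (in Mathlib's diagrammatic order, `R ⋙ M ⟶ M`). -/
structure LMod (R : Monad (Type u)) extends Type u ⥤ Type u where
  ρ : R.toFunctor ⋙ toFunctor ⟶ toFunctor
  assoc : ∀ X, ρ.app (R.obj X) ≫ ρ.app X = toFunctor.map (R.μ.app X) ≫ ρ.app X
  unit : ∀ X, toFunctor.map (R.η.app X) ≫ ρ.app X = 𝟙 (toFunctor.obj X)

/-- Morphisms of modules: linear natural transformations. -/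
@[ext]
structure LMod.Hom {R : Monad (Type u)} (M N : LMod R) where
  nat : M.toFunctor ⟶ N.toFunctor
  linear : ∀ X, M.ρ.app X ≫ nat.app X = nat.app (R.obj X) ≫ N.ρ.app X

/-- The category `Mod(R)`. -/
instance (R : Monad (Type u)) : Category (LMod R) where
  Hom := LMod.Hom
  id M :=
    { nat := 𝟙 M.toFunctor
      linear := fun X => by simp }
  comp f g :=
    { nat := f.nat ≫ g.nat
      linear := fun X => by
        rw [NatTrans.comp_app, NatTrans.comp_app, ← Category.assoc, f.linear, Category.assoc,
          g.linear, Category.assoc] }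
  id_comp f := LMod.Hom.ext (Category.id_comp f.nat)
  comp_id f := LMod.Hom.ext (Category.comp_id f.nat)
  assoc f g h := LMod.Hom.ext (Category.assoc f.nat g.nat h.nat)

/-- The tautological module of a monad. -/
abbrev LMod.taut (R : Monad (Type u)) : LMod R where
  toFunctor := R.toFunctor
  ρ := R.μ
  assoc X := (R.assoc X).symm
  unit X := R.right_unit X

/-- The pullback `f^* M` of an `S`-module along a monad morphism `f : R ⟶ S`. -/
abbrev LMod.pullback {R S : Monad (Type u)} (f : R ⟶ S) (M : LMod S) : LMod R where
  toFunctor := M.toFunctor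
  ρ :=
    { app := fun X => M.map (f.app X) ≫ M.ρ.app X
      naturality := fun X Y g => by
        have h := M.ρ.naturality g
        simp only [Functor.comp_map, Functor.comp_obj] at h ⊢
        rw [← Category.assoc, ← M.map_comp, f.naturality, M.map_comp, Category.assoc, h,
          Category.assoc] }
  assoc X := by
    have h := M.ρ.naturality (f.app X)
    simp only [Functor.comp_map, Functor.comp_obj] at h ⊢
    rw [← Category.assoc (M.map (R.μ.app X)), ← M.map_comp, f.app_μ]
    simp only [M.map_comp, Category.assoc]
    rw [← M.assoc, ← reassoc_of% h, ← M.map_comp_assoc, ← M.map_comp_assoc, f.naturality]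
  unit X := by
    simp only [Functor.comp_obj]
    rw [← Category.assoc, ← M.map_comp, f.app_η, M.unit]

/-- A monad morphism `f : R ⟶ S`, seen as a morphism of `R`-modules `R ⟶ f^* S`. -/
def LMod.tautMap {R S : Monad (Type u)} (f : R ⟶ S) :
    LMod.taut R ⟶ (LMod.taut S).pullback f where
  nat := f.toNatTrans
  linear X := by
    have h := f.app_μ X
    simp only [Category.assoc] at h
    refine h.trans ?_
    rw [← Category.assoc, f.naturality]
    exact Category.assoc _ _ _

/-- The functor `X ↦ X + *`. -/
def addPoint : Type u ⥤ Type u where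
  obj X := X ⊕ PUnit.{u + 1}
  map f := ↾(Sum.map f id)
  map_id X := by ext x; rcases x with x | x <;> rfl
  map_comp f g := by ext x; rcases x with x | x <;> rfl

/-- The inclusion `X ⟶ X + *`. -/
def addPointInl (X : Type u) : X ⟶ addPoint.obj X :=
  TypeCat.ofHom (Y := addPoint.obj X) (Sum.inl : X → X ⊕ PUnit.{u + 1})

/-- The added point of `X + *`. -/
def newPoint (X : Type u) : addPoint.obj X := (Sum.inr PUnit.unit : X ⊕ PUnit.{u + 1})

/-- Case distinction on `X + *`. -/
def addPointDesc {X Y : Type u} (f : X ⟶ Y) (y : Y) : addPoint.obj X ⟶ Y :=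
  TypeCat.ofHom (X := addPoint.obj X) (Sum.elim f (fun _ => y) : X ⊕ PUnit.{u + 1} → Y)

lemma addPoint_hom_ext {X Y : Type u} {f g : addPoint.obj X ⟶ Y}
    (h₁ : addPointInl X ≫ f = addPointInl X ≫ g) (h₂ : f (newPoint X) = g (newPoint X)) :
    f = g := by
  ext x
  rcases x with x | x
  · exact types_congr_hom h₁ x
  · exact h₂

@[simp]
lemma inl_desc {X Y : Type u} (f : X ⟶ Y) (y : Y) :
    addPointInl X ≫ addPointDesc f y = f := rfl

@[simp]
lemma inl_desc_comp {X Y Z : Type u} (f : X ⟶ Y) (y : Y) (g : Y ⟶ Z) :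
    addPointInl X ≫ addPointDesc f y ≫ g = f ≫ g := rfl

@[simp]
lemma desc_newPoint {X Y : Type u} (f : X ⟶ Y) (y : Y) :
    addPointDesc f y (newPoint X) = y := rfl

@[simp]
lemma inl_map {X Y : Type u} (f : X ⟶ Y) :
    addPointInl X ≫ addPoint.map f = f ≫ addPointInl Y := rfl

@[simp]
lemma inl_map_comp {X Y Z : Type u} (f : X ⟶ Y) (g : addPoint.obj Y ⟶ Z) :
    addPointInl X ≫ addPoint.map f ≫ g = f ≫ addPointInl Y ≫ g := rfl

@[simp]
lemma map_newPoint {X Y : Type u} (f : X ⟶ Y) :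
    addPoint.map f (newPoint X) = newPoint Y := rfl

/-- The map `R X + * ⟶ R (X + *)` which is `R (X ⟶ X + *)` on `R X` and sends the point to the
image of the point of `X + *` under the unit. -/
def dist (R : Monad (Type u)) (X : Type u) : addPoint.obj (R.obj X) ⟶ R.obj (addPoint.obj X) :=
  addPointDesc (R.map (addPointInl X)) (R.η.app (addPoint.obj X) (newPoint X))

lemma dist_naturality (R : Monad (Type u)) {X Y : Type u} (f : X ⟶ Y) :
    addPoint.map (R.map f) ≫ dist R Y = dist R X ≫ R.map (addPoint.map f) := by
  apply addPoint_hom_ext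
  · simp [dist, ← Functor.map_comp]
  · have h := NatTrans.naturality_apply R.η (addPoint.map f) (newPoint X)
    simpa [dist] using h

lemma dist_unit (R : Monad (Type u)) (X : Type u) :
    addPoint.map (R.η.app X) ≫ dist R X = R.η.app (addPoint.obj X) := by
  apply addPoint_hom_ext
  · have h := R.η.naturality (addPointInl X)
    simpa [dist] using h.symm
  · simp [dist]

lemma dist_mul (R : Monad (Type u)) (X : Type u) :
    addPoint.map (R.μ.app X) ≫ dist R X =
      dist R (R.obj X) ≫ R.map (dist R X) ≫ R.μ.app (addPoint.obj X) := by
  apply addPoint_hom_ext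
  · have h := R.μ.naturality (addPointInl X)
    simp only [Functor.comp_map] at h
    simp [dist, ← Functor.map_comp_assoc, h]
  · have h := NatTrans.naturality_apply R.η (dist R X) (newPoint (R.obj X))
    have h' := types_congr_hom (R.left_unit (addPoint.obj X)) (R.η.app _ (newPoint X))
    simp only [types_comp_apply, map_newPoint]
    simp only [dist, desc_newPoint, Functor.id_obj, Functor.id_map] at h h' ⊢
    erw [← h]
    exact h'.symm

lemma dist_hom {R S : Monad (Type u)} (f : R ⟶ S) (X : Type u) :
    dist R X ≫ f.app (addPoint.obj X) = addPoint.map (f.app X) ≫ dist S X := by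
  apply addPoint_hom_ext
  · simp [dist]
  · have h := types_congr_hom (f.app_η (addPoint.obj X)) (newPoint X)
    simp only [types_comp_apply, map_newPoint]
    simp only [dist, desc_newPoint]
    exact h

/-- The derivative `M' = M(- + *)` of a module, with substitution
`M (R X + *) ⟶ M (R (X + *)) ⟶ M (X + *)`. -/
def LMod.deriv {R : Monad (Type u)} (M : LMod R) : LMod R where
  toFunctor := addPoint ⋙ M.toFunctor
  ρ :=
    { app := fun X => M.map (dist R X) ≫ M.ρ.app (addPoint.obj X)
      naturality := fun X Y g => by
        have h := M.ρ.naturality (addPoint.map g)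
        simp only [Functor.comp_map, Functor.comp_obj] at h ⊢
        rw [← M.map_comp_assoc, dist_naturality, M.map_comp_assoc, h, Category.assoc] }
  assoc X := by
    have h := M.ρ.naturality (dist R X)
    simp only [Functor.comp_map, Functor.comp_obj] at h ⊢
    rw [← M.map_comp_assoc, dist_mul]
    simp only [M.map_comp, Category.assoc]
    rw [← M.assoc, reassoc_of% h]
  unit X := by
    simp only [Functor.comp_obj, Functor.comp_map]
    rw [← M.map_comp_assoc, dist_unit, M.unit]

/-- Derivation on morphisms over a monad morphism `f`. -/
def LMod.derivMap {R S : Monad (Type u)} (f : R ⟶ S) {M : LMod R} {N : LMod S}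
    (m : M ⟶ N.pullback f) : M.deriv ⟶ N.deriv.pullback f where
  nat := Functor.whiskerLeft addPoint m.nat
  linear X := by
    have h := m.linear (addPoint.obj X)
    have h' := m.nat.naturality (dist R X)
    dsimp [LMod.deriv, LMod.pullback] at h h' ⊢
    simp only [Category.assoc] at h ⊢
    rw [h, reassoc_of% h', ← N.map_comp_assoc, dist_hom, N.map_comp_assoc]

/-- The iterated derivative `M^(k)`. -/
def LMod.iterDeriv {R : Monad (Type u)} (M : LMod R) : ℕ → LMod R
  | 0 => M
  | k + 1 => (M.iterDeriv k).deriv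

/-- Iterated derivation on morphisms over a monad morphism. -/
def LMod.iterDerivMap {R S : Monad (Type u)} (f : R ⟶ S) {M : LMod R} {N : LMod S}
    (m : M ⟶ N.pullback f) : (k : ℕ) → (M.iterDeriv k ⟶ (N.iterDeriv k).pullback f)
  | 0 => m
  | k + 1 => LMod.derivMap f (LMod.iterDerivMap f m k)

/-- The product `M_1 × ⋯ × M_n` of a finite family of modules (the final module if `n = 0`). -/
def LMod.prod {R : Monad (Type u)} {n : ℕ} (M : Fin n → LMod R) : LMod R where
  obj X := ∀ i, (M i).obj X
  map f := ↾(fun x i => (M i).map f (x i))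
  map_id X := by
    ext x i
    exact (M i).map_id_apply X (x i)
  map_comp f g := by
    ext x i
    exact (M i).map_comp_apply f g (x i)
  ρ :=
    { app := fun X => ↾(fun x i => (M i).ρ.app X (x i))
      naturality := fun X Y g => by
        ext x i
        exact NatTrans.naturality_apply (M i).ρ g (x i) }
  assoc X := by
    ext x i
    exact types_congr_hom ((M i).assoc X) (x i)
  unit X := by
    ext x i
    exact types_congr_hom ((M i).unit X) (x i)

/-- Finite products of morphisms over a monad morphism. -/
def LMod.prodMap {R S : Monad (Type u)} (f : R ⟶ S) {n : ℕ} {M : Fin n → LMod R}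
    {N : Fin n → LMod S} (m : ∀ i, M i ⟶ (N i).pullback f) :
    LMod.prod M ⟶ (LMod.prod N).pullback f where
  nat :=
    { app := fun X => ↾(fun x i => (m i).nat.app X (x i))
      naturality := fun X Y g => by
        ext x
        funext i
        exact NatTrans.naturality_apply (m i).nat g (x i) }
  linear X := by
    ext x
    funext i
    exact types_congr_hom ((m i).linear X) (x i)

/-- The module `M^(s) = M^(s_1) × ⋯ × M^(s_n)` for a list `s = (s_1, …, s_n)`. -/
def LMod.listDeriv {R : Monad (Type u)} (M : LMod R) (s : List ℕ) : LMod R :=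
  LMod.prod fun i : Fin s.length => M.iterDeriv (s.get i)

/-- The total module category `∫ Mod`: its objects are pairs of a monad and a module over it. -/
structure TotalMod where
  base : Monad (Type u)
  mod : LMod base

/-- Morphisms `(R, M) ⟶ (S, N)` of the total module category. -/
structure TotalMod.Hom (A B : TotalMod.{u}) where
  base : A.base ⟶ B.base
  mod : A.mod ⟶ B.mod.pullback base

lemma TotalMod.Hom.ext' {A B : TotalMod.{u}} {f g : TotalMod.Hom A B} (h : f.base = g.base)
    (h' : ∀ X, f.mod.nat.app X = g.mod.nat.app X) : f = g := by
  obtain ⟨f, m⟩ := f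
  obtain ⟨g, n⟩ := g
  obtain rfl : f = g := h
  congr 1
  exact LMod.Hom.ext (NatTrans.ext (funext h'))

instance : Category TotalMod.{u} where
  Hom := TotalMod.Hom
  id A :=
    { base := 𝟙 A.base
      mod :=
        { nat := 𝟙 A.mod.toFunctor
          linear := fun X => by
            have h : A.mod.map ((𝟙 A.base : A.base ⟶ A.base).app X) = 𝟙 _ := A.mod.map_id _
            change A.mod.ρ.app X ≫ 𝟙 _ = 𝟙 _ ≫ A.mod.map (𝟙 _) ≫ A.mod.ρ.app X
            simp } }
  comp {A B C} f g :=
    { base := f.base ≫ g.base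
      mod :=
        { nat := f.mod.nat ≫ (show B.mod.toFunctor ⟶ C.mod.toFunctor from g.mod.nat)
          linear := fun X => by
            have h₁ := f.mod.linear X
            have h₂ := g.mod.linear X
            have h₃ := g.mod.nat.naturality (f.base.app X)
            dsimp [LMod.pullback] at h₁ h₂ h₃ ⊢
            simp only [Category.assoc, Functor.map_comp] at h₁ h₂ h₃ ⊢
            rw [reassoc_of% h₁, h₂, reassoc_of% h₃] } }
  id_comp f := TotalMod.Hom.ext' (Category.id_comp f.base) fun X => Category.id_comp _
  comp_id f := TotalMod.Hom.ext' (Category.comp_id f.base) fun X => Category.comp_id _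
  assoc f g h := TotalMod.Hom.ext' (Category.assoc f.base g.base h.base) fun X =>
    Category.assoc _ _ _

/-- The forgetful functor `∫ Mod ⥤ Mon`. -/
def TotalMod.forget : TotalMod.{u} ⥤ Monad (Type u) where
  obj A := A.base
  map f := f.base

/-- A signature: a section of the forgetful functor `∫ Mod ⥤ Mon`, given by its second components:
functorially, an `R`-module for each monad `R` and a morphism of modules `Σ(R) ⟶ f^* Σ(S)` for each
monad morphism `f : R ⟶ S`. -/
structure Signature where
  obj (R : Monad (Type u)) : LMod R
  map {R S : Monad (Type u)} (f : R ⟶ S) : obj R ⟶ (obj S).pullback f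
  map_id (R : Monad (Type u)) (X : Type u) : (map (𝟙 R)).nat.app X = 𝟙 ((obj R).obj X)
  map_comp {R S T : Monad (Type u)} (f : R ⟶ S) (g : S ⟶ T) (X : Type u) :
    (map (f ≫ g)).nat.app X = (map f).nat.app X ≫ (map g).nat.app X

/-- A signature as a functor to the total module category. -/
def Signature.toFunctor (S : Signature.{u}) : Monad (Type u) ⥤ TotalMod.{u} where
  obj R := ⟨R, S.obj R⟩
  map f := ⟨f, S.map f⟩
  map_id R := TotalMod.Hom.ext' rfl (S.map_id R)
  map_comp f g := TotalMod.Hom.ext' rfl (S.map_comp f g)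

/-- A signature is a section of the forgetful functor. -/
lemma Signature.toFunctor_comp_forget (S : Signature.{u}) :
    S.toFunctor ⋙ TotalMod.forget = 𝟭 (Monad (Type u)) := rfl

/-- Every section of the forgetful functor is a signature. -/
lemma Signature.exists_toFunctor_eq (F : Monad (Type u) ⥤ TotalMod.{u})
    (h : F ⋙ TotalMod.forget = 𝟭 (Monad (Type u))) : ∃ S : Signature.{u}, S.toFunctor = F := by
  obtain ⟨o, m, hid, hcomp⟩ := F
  obtain ⟨N, rfl⟩ : ∃ N : ∀ R, LMod R, o = fun R => ⟨R, N R⟩ := by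
    have h₀ : ∀ R, (o R).base = R := fun R => congrArg (fun G => G.obj R) h
    have h₁ : ∀ R, ∃ N : LMod R, o R = ⟨R, N⟩ := fun R => by
      have h₂ := h₀ R
      generalize o R = A at h₂
      subst h₂
      exact ⟨A.mod, rfl⟩
    choose N hN using h₁
    exact ⟨N, funext hN⟩
  have hm : ∀ {R S : Monad (Type u)} (f : R ⟶ S), (m f).base = f := fun {R S} f => by
    have h₁ := Functor.congr_hom h f
    exact h₁.trans ((Category.id_comp (f ≫ 𝟙 S)).trans (Category.comp_id f))
  obtain ⟨t, rfl⟩ : ∃ t : ∀ {R S : Monad (Type u)} (f : R ⟶ S), N R ⟶ (N S).pullback f,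
      @m = fun {R S} f => ⟨f, t f⟩ := by
    have h₁ : ∀ (R S : Monad (Type u)) (f : R ⟶ S), ∃ t : N R ⟶ (N S).pullback f,
        m f = ⟨f, t⟩ := fun R S f => by
      have h₂ := hm f
      generalize m f = g at h₂
      subst h₂
      exact ⟨g.mod, rfl⟩
    choose t ht using h₁
    exact ⟨fun {R S} f => t R S f, by funext R S f; exact ht R S f⟩
  refine ⟨⟨N, t, fun R X => ?_, fun f g X => ?_⟩, rfl⟩
  · have h₁ := hid R
    have h₂ := (TotalMod.Hom.mk.injEq _ _ _ _).mp h₁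
    exact congrArg (fun a => LMod.Hom.nat a |>.app X) (eq_of_heq h₂.2)
  · have h₁ := hcomp f g
    have h₂ := (TotalMod.Hom.mk.injEq _ _ _ _).mp h₁
    exact congrArg (fun a => LMod.Hom.nat a |>.app X) (eq_of_heq h₂.2)

/-- A morphism of signatures: a natural transformation over the identity of `Mon`, that is,
a family of morphisms of `R`-modules natural in the monad `R`. -/
@[ext]
structure Signature.Hom (S T : Signature.{u}) where
  app (R : Monad (Type u)) : S.obj R ⟶ T.obj R
  naturality {R R' : Monad (Type u)} (f : R ⟶ R') (X : Type u) :
    (S.map f).nat.app X ≫ (app R').nat.app X = (app R).nat.app X ≫ (T.map f).nat.app X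

/-- The category of signatures. -/
instance : Category Signature.{u} where
  Hom := Signature.Hom
  id S :=
    { app := fun R => 𝟙 (S.obj R)
      naturality := fun {R R'} f X =>
        (Category.comp_id ((S.map f).nat.app X)).trans
          (Category.id_comp ((S.map f).nat.app X)).symm }
  comp a b :=
    { app := fun R => a.app R ≫ b.app R
      naturality := fun {R R'} f X => by
        have h₁ := a.naturality f X
        have h₂ := b.naturality f X
        change _ ≫ (a.app R').nat.app X ≫ (b.app R').nat.app X =
          ((a.app R).nat.app X ≫ (b.app R).nat.app X) ≫ _
        rw [reassoc_of% h₁, h₂, Category.assoc] }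
  id_comp a := Signature.Hom.ext (funext fun R => Category.id_comp (a.app R))
  comp_id a := Signature.Hom.ext (funext fun R => Category.comp_id (a.app R))
  assoc a b c := Signature.Hom.ext (funext fun R => Category.assoc (a.app R) (b.app R) (c.app R))

lemma iterDerivMap_id (R : Monad (Type u)) (k : ℕ) (X : Type u) :
    (LMod.iterDerivMap (𝟙 R) (LMod.tautMap (𝟙 R)) k).nat.app X =
      𝟙 (((LMod.taut R).iterDeriv k).obj X) := by
  induction k generalizing X with
  | zero => rfl
  | succ k ih => exact ih (addPoint.obj X)

lemma iterDerivMap_comp {R S T : Monad (Type u)} (f : R ⟶ S) (g : S ⟶ T) (k : ℕ) (X : Type u) :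
    (LMod.iterDerivMap (f ≫ g) (LMod.tautMap (f ≫ g)) k).nat.app X =
      (LMod.iterDerivMap f (LMod.tautMap f) k).nat.app X ≫
        (LMod.iterDerivMap g (LMod.tautMap g) k).nat.app X := by
  induction k generalizing X with
  | zero => rfl
  | succ k ih => exact ih (addPoint.obj X)

/-- The elementary signature `Θ^(s) : R ↦ R^(s_1) × ⋯ × R^(s_n)`. -/
def Signature.elementary (s : List ℕ) : Signature.{u} where
  obj R := (LMod.taut R).listDeriv s
  map f := LMod.prodMap f fun i => LMod.iterDerivMap f (LMod.tautMap f) (s.get i)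
  map_id R X := by
    ext x
    funext i
    exact types_congr_hom (iterDerivMap_id R (s.get i) X) (x i)
  map_comp f g X := by
    ext x
    funext i
    exact types_congr_hom (iterDerivMap_comp f g (s.get i) X) (x i)

/-- An algebraic signature: a (possibly infinite) coproduct, in the category of signatures, of
elementary signatures. -/
def Signature.IsAlgebraic (S : Signature.{u}) : Prop :=
  ∃ (I : Type u) (s : I → List ℕ) (ι : ∀ i, Signature.elementary (s i) ⟶ S),
    Nonempty (Limits.IsColimit (Limits.Cofan.mk S ι))

/-- A signature is presentable if there is an epimorphism of signatures onto it from an algebraic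
signature. -/
def Signature.IsPresentable (S : Signature.{u}) : Prop :=
  ∃ (Y : Signature.{u}) (p : Y ⟶ S), Y.IsAlgebraic ∧ Epi p

/-- A model of a signature: a monad `R` with an action `Σ(R) ⟶ R`, a morphism of `R`-modules. -/
structure Model (S : Signature.{u}) where
  monad : Monad (Type u)
  action : S.obj monad ⟶ LMod.taut monad

/-- A morphism of models: a monad morphism compatible with the actions. -/
@[ext]
structure Model.Hom {S : Signature.{u}} (A B : Model S) where
  hom : A.monad ⟶ B.monad
  comm : ∀ X, A.action.nat.app X ≫ hom.app X = (S.map hom).nat.app X ≫ B.action.nat.app X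

/-- The category `Mon^Σ` of models of a signature. -/
instance (S : Signature.{u}) : Category (Model S) where
  Hom := Model.Hom
  id A :=
    { hom := 𝟙 A.monad
      comm := fun X => by
        rw [S.map_id]
        exact (Category.comp_id (A.action.nat.app X)).trans
          (Category.id_comp (A.action.nat.app X)).symm }
  comp a b :=
    { hom := a.hom ≫ b.hom
      comm := fun X => by
        have h₁ := a.comm X
        have h₂ := b.comm X
        rw [S.map_comp, Category.assoc]
        erw [← h₂]
        rw [← reassoc_of% h₁]
        rfl }
  id_comp a := Model.Hom.ext (Category.id_comp a.hom)
  comp_id a := Model.Hom.ext (Category.comp_id a.hom)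
  assoc a b c := Model.Hom.ext (Category.assoc a.hom b.hom c.hom)

/-- A signature is representable if its category of models has an initial object. -/
def Signature.IsRepresentable (S : Signature.{u}) : Prop :=
  Limits.HasInitial (Model S)

end ModSig

/-! Let `p i` be the composites of the coproduct injections with the given epimorphism. They are
jointly epimorphic, hence pointwise jointly surjective: if their joint image were a proper
subsignature, the quotient map to the signature collapsing it to an added point and the constant map
to that point would be distinct but agree on the image (`exists_app_eq_of_jointly_epi`). The initial
model is the smallest submodel of the product of all models. That product is too large, but the
families built from variables by the operations `p i` are denoted by syntactic terms, so over each
`X` they form a small type (`small_generated`). They are stable under substitution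
(`Generated.subst`), hence form a monad that projects to every model. Joint surjectivity makes them
stable under the action of the whole signature (`generated_action`); the action is computed in each
model, so it depends on no choice of preimages under `p i`. The projections give existence of
morphisms out of this model. Uniqueness holds by induction on generation
(`Generated.exists_preimage`). -/

namespace ModSig

/-! ### Generated families of elements of all models -/

section Generated

variable {S : Signature.{u}} {I : Type u} {s : I → List ℕ}
  (p : ∀ i, Signature.elementary (s i) ⟶ S)

/-- The families of elements of `M^(k) X`, indexed by all models `M` of `S`, which are generated
by the units and by the operations `p i`. -/
inductive Generated : (k : ℕ) → (X : Type u) →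
    (∀ M : Model S, ((LMod.taut M.monad).iterDeriv k).obj X) → Prop
  | var {X : Type u} (x : X) : Generated 0 X fun M => M.monad.η.app X x
  | op {X : Type u} (i : I)
      (a : ∀ (M : Model S) (j : Fin (s i).length),
        ((LMod.taut M.monad).iterDeriv ((s i).get j)).obj X)
      (h : ∀ j, Generated ((s i).get j) X fun M => a M j) :
      Generated 0 X fun M => M.action.nat.app X (((p i).app M.monad).nat.app X (a M))
  | bind {X : Type u} {k : ℕ}
      (a : ∀ M : Model S, ((LMod.taut M.monad).iterDeriv k).obj (addPoint.obj X))
      (h : Generated k (addPoint.obj X) a) : Generated (k + 1) X a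

variable {p}

/-! ### Stability of generated families under renaming and substitution -/

lemma Generated.congr {k : ℕ} {X : Type u}
    {a b : ∀ M : Model S, ((LMod.taut M.monad).iterDeriv k).obj X} (h : Generated p k X a)
    (e : ∀ M, a M = b M) : Generated p k X b :=
  funext e ▸ h

/-- Renaming comes before substitution because pushing a substitution under a binder requires
weakening its values. -/
lemma Generated.map {k : ℕ} {X : Type u}
    {a : ∀ M : Model S, ((LMod.taut M.monad).iterDeriv k).obj X} (h : Generated p k X a) :
    ∀ {Y : Type u} (f : X ⟶ Y),
      Generated p k Y fun M => ((LMod.taut M.monad).iterDeriv k).map f (a M) := by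
  induction h with
  | @var X x =>
    intro Y f
    refine (Generated.var (f x)).congr fun M => ?_
    exact NatTrans.naturality_apply M.monad.η f x
  | @op X i a h ih =>
    intro Y f
    refine (Generated.op i (fun M j => ((LMod.taut M.monad).iterDeriv ((s i).get j)).map f (a M j))
      fun j => ih j f).congr fun M => ?_
    have h₁ := NatTrans.naturality_apply M.action.nat f (((p i).app M.monad).nat.app X (a M))
    have h₂ := NatTrans.naturality_apply ((p i).app M.monad).nat f (a M)
    exact (congrArg (M.action.nat.app Y) h₂).trans h₁
  | @bind X k a h ih =>
    intro Y f
    exact Generated.bind _ (ih (addPoint.map f))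

/-- Operations commute with substitution because both `p i` and the actions are module morphisms.
This provides the multiplication of the initial monad. -/
lemma Generated.subst {k : ℕ} {X : Type u}
    {a : ∀ M : Model S, ((LMod.taut M.monad).iterDeriv k).obj X} (h : Generated p k X a) :
    ∀ {Y : Type u} (f : ∀ M : Model S, X ⟶ M.monad.obj Y)
      (_ : ∀ x, Generated p 0 Y fun M => f M x),
      Generated p k Y fun M => ((LMod.taut M.monad).iterDeriv k).ρ.app Y
        (((LMod.taut M.monad).iterDeriv k).map (f M) (a M)) := by
  induction h with
  | @var X x =>
    intro Y f hf
    refine (hf x).congr fun M => Eq.symm ?_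
    have h₁ := NatTrans.naturality_apply M.monad.η (f M) x
    have h₂ := types_congr_hom (M.monad.left_unit Y) (f M x)
    exact (congrArg (M.monad.μ.app Y) h₁.symm).trans h₂
  | @op X i a h ih =>
    intro Y f hf
    refine (Generated.op i (fun M j =>
      ((LMod.taut M.monad).iterDeriv ((s i).get j)).ρ.app Y
        (((LMod.taut M.monad).iterDeriv ((s i).get j)).map (f M) (a M j)))
      fun j => ih j f hf).congr fun M => Eq.symm ?_
    have h₁ := NatTrans.naturality_apply M.action.nat (f M) (((p i).app M.monad).nat.app X (a M))
    have h₂ := NatTrans.naturality_apply ((p i).app M.monad).nat (f M) (a M)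
    have h₃ := types_congr_hom (M.action.linear Y)
      (((S.obj M.monad).map (f M)) (((p i).app M.monad).nat.app X (a M)))
    have h₄ := types_congr_hom (((p i).app M.monad).linear Y)
      (((Signature.elementary (s i)).obj M.monad).map (f M) (a M))
    refine (congrArg (M.monad.μ.app Y) h₁.symm).trans (h₃.symm.trans ?_)
    refine congrArg (M.action.nat.app Y) ?_
    exact (congrArg ((S.obj M.monad).ρ.app Y) h₂.symm).trans h₄.symm
  | @bind X k a h ih =>
    intro Y f hf
    refine Generated.bind _ ((ih (fun M => addPoint.map (f M) ≫ dist M.monad Y) ?_).congr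
      fun M => ?_)
    -- Under a binder, the values at old variables are weakened and the new variable is sent to
    -- itself.
    · rintro (x | x)
      · exact (hf x).map (addPointInl Y)
      · exact Generated.var (newPoint Y)
    · exact congrArg (((LMod.taut M.monad).iterDeriv k).ρ.app (addPoint.obj Y))
        (Functor.map_comp_apply ((LMod.taut M.monad).iterDeriv k).toFunctor _ _ (a M))

/-- The type `X + * + ⋯ + *` with `n` points added. -/
def addPoints (X : Type u) : ℕ → Type u
  | 0 => X
  | n + 1 => addPoint.obj (addPoints X n)

/-- Codes for the generated families of elements of `M^(k) (X + * + ⋯ + *)`, with `n` points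
added. -/
inductive Code (s : I → List ℕ) (X : Type u) : ℕ → ℕ → Type u
  | var {n : ℕ} (x : addPoints X n) : Code s X n 0
  | op {n : ℕ} (i : I) (a : ∀ j : Fin (s i).length, Code s X n ((s i).get j)) : Code s X n 0
  | bind {n k : ℕ} (a : Code s X (n + 1) k) : Code s X n (k + 1)

/-- The family denoted by a code. -/
def Code.eval (p : ∀ i, Signature.elementary (s i) ⟶ S) {X : Type u} : {n k : ℕ} → Code s X n k →
    ∀ M : Model S, ((LMod.taut M.monad).iterDeriv k).obj (addPoints X n)
  | n, _, .var x => fun M => M.monad.η.app (addPoints X n) x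
  | n, _, .op i a => fun M => M.action.nat.app (addPoints X n)
      (((p i).app M.monad).nat.app (addPoints X n) fun j => (a j).eval p M)
  | _, _, .bind a => fun M => a.eval p M

/-- Generation varies the context over all of `Type u`, but a derivation ending over `X` only meets
contexts `X + * + ⋯ + *`. Recording just the number of added points keeps codes in `Type u`; the
equation `e` lets the induction run with a variable context. -/
lemma Generated.exists_code {X : Type u} {k : ℕ} {Z : Type u}
    {a : ∀ M : Model S, ((LMod.taut M.monad).iterDeriv k).obj Z} (h : Generated p k Z a) :
    ∀ (n : ℕ) (e : addPoints X n = Z), ∃ c : Code s X n k, e ▸ c.eval p = a := by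
  induction h with
  | var x =>
    rintro n rfl
    exact ⟨.var x, rfl⟩
  | op i a h ih =>
    rintro n rfl
    choose c hc using fun j => ih j n rfl
    refine ⟨.op i c, funext fun M => ?_⟩
    have : (fun j => (c j).eval p M) = a M := funext fun j => congrFun (hc j) M
    exact congrArg (fun b => M.action.nat.app _ (((p i).app M.monad).nat.app _ b)) this
  | bind a h ih =>
    rintro n rfl
    obtain ⟨c, hc⟩ := ih (n + 1) rfl
    exact ⟨.bind c, hc⟩

variable (p)

/-- Families indexed by all models form a large type, but the generated ones lie in the range of
`Code.eval`, whose domain is in `Type u`. -/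
instance small_generated (X : Type u) : Small.{u} {a // Generated p 0 X a} := by
  have h : {a | Generated p 0 X a} ⊆ Set.range fun c : Code s X 0 0 => c.eval p :=
    fun a h => Generated.exists_code (X := X) h 0 rfl
  have := small_range.{u} fun c : Code s X 0 0 => c.eval p
  exact @small_subset _ _ _ h this

end Generated

/-! ### The initial model -/

section Initial

variable {S : Signature.{u}} {I : Type u} {s : I → List ℕ}
  (p : ∀ i, Signature.elementary (s i) ⟶ S)

/-- A small copy of the type of generated families of elements of `M X`. -/
def initialObj (X : Type u) : Type u :=
  Shrink.{u} {a // Generated p 0 X a}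

/-- The component of a generated family at a model. -/
noncomputable def initialProj (M : Model S) (X : Type u) : initialObj p X ⟶ M.monad.obj X :=
  ↾(fun q => ((equivShrink _).symm q).1 M)

lemma initialProj_generated {X : Type u} (q : initialObj p X) :
    Generated p 0 X fun M => initialProj p M X q :=
  ((equivShrink _).symm q).2

variable {p} in
lemma initialObj_ext {X : Type u} {q r : initialObj p X}
    (h : ∀ M, initialProj p M X q = initialProj p M X r) : q = r :=
  (equivShrink _).symm.injective (Subtype.ext (funext h))

variable {p} in
/-- The element of `initialObj p X` given by a generated family. -/
noncomputable def initialMk {X : Type u} (a : ∀ M : Model S, M.monad.obj X)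
    (h : Generated p 0 X a) : initialObj p X :=
  equivShrink _ ⟨a, h⟩

variable {p} in
lemma initialProj_mk {X : Type u} (a : ∀ M : Model S, M.monad.obj X) (h : Generated p 0 X a)
    (M : Model S) : initialProj p M X (initialMk a h) = a M :=
  congrArg (fun b : {a // Generated p 0 X a} => b.1 M)
    ((equivShrink {a // Generated p 0 X a}).symm_apply_apply ⟨a, h⟩)

variable {p} in
-- The projections are jointly monic, so each law for the generated monad and its action can be
-- checked in every model separately.
lemma initialObj_hom_ext {X Z : Type u} {f g : Z ⟶ initialObj p X}
    (h : ∀ M, f ≫ initialProj p M X = g ≫ initialProj p M X) : f = g := by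
  ext z
  exact initialObj_ext fun M => types_congr_hom (h M) z

/-- Functoriality of `initialObj`. -/
noncomputable def initialMap {X Y : Type u} (f : X ⟶ Y) : initialObj p X ⟶ initialObj p Y :=
  ↾(fun q => initialMk (fun M => M.monad.map f (initialProj p M X q))
    ((initialProj_generated p q).map f))

lemma initialMap_proj {X Y : Type u} (f : X ⟶ Y) (M : Model S) :
    initialMap p f ≫ initialProj p M Y = initialProj p M X ≫ M.monad.map f := by
  ext q
  exact initialProj_mk _ _ M

/-- The unit of `initialMonad`. -/
noncomputable def initialUnit (X : Type u) : X ⟶ initialObj p X :=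
  ↾(fun x => initialMk (fun M => M.monad.η.app X x) (Generated.var x))

lemma initialUnit_proj (X : Type u) (M : Model S) :
    initialUnit p X ≫ initialProj p M X = M.monad.η.app X := by
  ext x
  exact initialProj_mk _ _ M

/-- The multiplication of `initialMonad`. -/
noncomputable def initialMul (X : Type u) : initialObj p (initialObj p X) ⟶ initialObj p X :=
  ↾(fun q => initialMk
    (fun M => M.monad.μ.app X (M.monad.map (initialProj p M X) (initialProj p M _ q)))
    ((initialProj_generated p q).subst (fun M => initialProj p M X) (initialProj_generated p)))

lemma initialMul_proj (X : Type u) (M : Model S) :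
    initialMul p X ≫ initialProj p M X =
      initialProj p M _ ≫ M.monad.map (initialProj p M X) ≫ M.monad.μ.app X := by
  ext q
  exact initialProj_mk _ _ M

/-- The submonad of the product of all models generated by the operations `p i`. -/
noncomputable def initialMonad : Monad (Type u) where
  obj := initialObj p
  map := initialMap p
  map_id X := initialObj_hom_ext fun M => by simp [initialMap_proj]
  map_comp f g := initialObj_hom_ext fun M => by simp [initialMap_proj, reassoc_of% @initialMap_proj]
  η :=
    { app := initialUnit p
      naturality X Y f := initialObj_hom_ext fun M => by
        simp [initialMap_proj, initialUnit_proj, reassoc_of% @initialUnit_proj,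
          Monad.unit_naturality] }
  μ :=
    { app := initialMul p
      naturality X Y f := initialObj_hom_ext fun M => by
        change (initialMap p (initialMap p f) ≫ initialMul p Y) ≫ _ =
          (initialMul p X ≫ initialMap p f) ≫ _
        rw [Category.assoc, Category.assoc, initialMul_proj, reassoc_of% @initialMap_proj,
          initialMap_proj, reassoc_of% @initialMul_proj, ← Functor.map_comp_assoc, initialMap_proj,
          Functor.map_comp, Category.assoc, Monad.mu_naturality] }
  assoc X := initialObj_hom_ext fun M => by
    change (initialMap p (initialMul p X) ≫ initialMul p X) ≫ _ =
      (initialMul p (initialObj p X) ≫ initialMul p X) ≫ _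
    rw [Category.assoc, Category.assoc, initialMul_proj, reassoc_of% @initialMap_proj,
      reassoc_of% @initialMul_proj, ← Functor.map_comp_assoc, initialMul_proj, Functor.map_comp,
      Functor.map_comp, Category.assoc, Category.assoc, M.monad.assoc,
      Monad.mu_naturality_assoc]
  left_unit X := initialObj_hom_ext fun M => by
    change (initialUnit p (initialObj p X) ≫ initialMul p X) ≫ _ = 𝟙 _ ≫ _
    rw [Category.assoc, initialMul_proj, reassoc_of% @initialUnit_proj,
      ← Monad.unit_naturality_assoc, M.monad.left_unit]
    rfl
  right_unit X := initialObj_hom_ext fun M => by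
    simp [reassoc_of% @initialMap_proj, initialMul_proj, ← Functor.map_comp_assoc, initialUnit_proj]

/-- The projection to a model, as a morphism of monads. -/
noncomputable def initialHom (M : Model S) : initialMonad p ⟶ M.monad where
  app := initialProj p M
  naturality _ _ f := initialMap_proj p f M
  app_η X := initialUnit_proj p X M
  app_μ X := by
    have h := initialMul_proj p X M
    have h' := initialMap_proj p (initialProj p M X) M
    refine h.trans ?_
    rw [← Category.assoc]
    exact congrArg (· ≫ M.monad.μ.app X) h'.symm

/-- An element of the `k`-th derivative is an element of the monad itself over a context with `k`
more points; it is generated there, and `k` uses of `bind` bring it back. -/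
lemma generated_iterDerivMap {k : ℕ} {X : Type u}
    (q : ((LMod.taut (initialMonad p)).iterDeriv k).obj X) :
    Generated p k X fun M =>
      (LMod.iterDerivMap (initialHom p M) (LMod.tautMap (initialHom p M)) k).nat.app X q := by
  induction k generalizing X with
  | zero => exact initialProj_generated p q
  | succ k ih => exact Generated.bind _ (ih (X := addPoint.obj X) q)

/-! ### The action on the generated monad, and initiality -/

variable (hp : ∀ (R : Monad (Type u)) (X : Type u) (x : (S.obj R).obj X),
  ∃ i y, ((p i).app R).nat.app X y = x)

include hp in
-- Joint surjectivity is needed exactly here: once `x` comes from some `p i`, naturality of `p i`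
-- along the projections exhibits the family as an operation applied to generated arguments.
lemma generated_action {X : Type u} (x : (S.obj (initialMonad p)).obj X) :
    Generated p 0 X fun M =>
      M.action.nat.app X ((S.map (initialHom p M)).nat.app X x) := by
  obtain ⟨i, y, rfl⟩ := hp _ X x
  refine (Generated.op i (fun M j => (LMod.iterDerivMap (initialHom p M)
    (LMod.tautMap (initialHom p M)) _).nat.app X (y j))
    fun j => generated_iterDerivMap p (y j)).congr fun M => ?_
  exact congrArg (M.action.nat.app X) (types_congr_hom ((p i).naturality (initialHom p M) X) y)

/-- The action of `S` on `initialMonad`, on underlying types. -/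
noncomputable def initialAction (X : Type u) : (S.obj (initialMonad p)).obj X ⟶ initialObj p X :=
  ↾(fun x => initialMk _ (generated_action p hp x))

lemma initialAction_proj (X : Type u) (M : Model S) :
    initialAction p hp X ≫ initialProj p M X =
      (S.map (initialHom p M)).nat.app X ≫ M.action.nat.app X := by
  ext x
  exact initialProj_mk _ _ M

/-- The model of `S` on `initialMonad`. -/
noncomputable def initialModel : Model S where
  monad := initialMonad p
  action :=
    { nat :=
        { app := initialAction p hp
          naturality X Y f := initialObj_hom_ext fun M => by
            have h₁ := (S.map (initialHom p M)).nat.naturality f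
            have h₂ := M.action.nat.naturality f
            have h₃ := initialMap_proj p f M
            change (_ ≫ initialAction p hp Y) ≫ _ = (initialAction p hp X ≫ initialMap p f) ≫ _
            rw [Category.assoc, initialAction_proj, Category.assoc, h₃,
              ← Category.assoc (initialAction p hp X), initialAction_proj, Category.assoc]
            rw [← Category.assoc]
            refine (congrArg (· ≫ M.action.nat.app Y) h₁).trans ?_
            rw [Category.assoc]
            exact congrArg ((S.map (initialHom p M)).nat.app X ≫ ·) h₂ }
      linear X := initialObj_hom_ext fun M => by
        ext x
        have h₁ := types_congr_hom ((S.map (initialHom p M)).linear X) x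
        have h₂ := types_congr_hom (M.action.linear X)
          ((S.obj M.monad).map (initialProj p M X)
            ((S.map (initialHom p M)).nat.app (initialObj p X) x))
        have h₃ := types_congr_hom (initialAction_proj p hp X M)
          ((S.obj (initialMonad p)).ρ.app X x)
        have h₄ := types_congr_hom (initialMul_proj p X M) (initialAction p hp _ x)
        have h₅ := types_congr_hom (initialAction_proj p hp (initialObj p X) M) x
        have h₆ := NatTrans.naturality_apply M.action.nat (initialProj p M X)
          ((S.map (initialHom p M)).nat.app (initialObj p X) x)
        -- Projected to `M`, linearity reduces to linearity of `S.map (initialHom p M)` and of the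
        -- action of `M`.
        refine h₃.trans (Eq.trans ?_ h₄.symm)
        refine (congrArg (M.action.nat.app X) h₁).trans (h₂.trans ?_)
        refine congrArg (M.monad.μ.app X) (h₆.trans ?_)
        exact congrArg (M.monad.map (initialProj p M X)) h₅.symm }

/-- The projection to a model, as a morphism of models. -/
noncomputable def initialModelHom (M : Model S) : initialModel p hp ⟶ M where
  hom := initialHom p M
  comm X := initialAction_proj p hp X M

/-- This is uniqueness in inductive form: one element `q` has the prescribed projections and also
the prescribed image under `f`. At level `0` the projections determine `q`, so `f` must agree with
the projection to `M`. -/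
lemma Generated.exists_preimage (M : Model S) (f : initialModel p hp ⟶ M) {k : ℕ} {X : Type u}
    {a : ∀ N : Model S, ((LMod.taut N.monad).iterDeriv k).obj X} (h : Generated p k X a) :
    ∃ q : ((LMod.taut (initialMonad p)).iterDeriv k).obj X,
      (∀ N, (LMod.iterDerivMap (initialHom p N) (LMod.tautMap (initialHom p N)) k).nat.app X q =
        a N) ∧
      (LMod.iterDerivMap f.hom (LMod.tautMap f.hom) k).nat.app X q = a M := by
  induction h with
  | @var X x =>
    exact ⟨initialUnit p X x, fun N => types_congr_hom (initialUnit_proj p X N) x,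
      types_congr_hom (f.hom.app_η X) x⟩
  | @op X i a h ih =>
    choose q hq hf using ih
    -- The claim is made for an arbitrary morphism `g` so as to serve both for the projections and
    -- for `f`.
    have hcomm : ∀ (N : Model S) (g : initialModel p hp ⟶ N)
        (_ : ∀ j, (LMod.iterDerivMap g.hom (LMod.tautMap g.hom) _).nat.app X (q j) = a N j),
        g.hom.app X (initialAction p hp X (((p i).app (initialMonad p)).nat.app X q)) =
          N.action.nat.app X (((p i).app N.monad).nat.app X (a N)) := fun N g hg => by
      have h₁ := types_congr_hom (g.comm X) (((p i).app (initialMonad p)).nat.app X q)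
      have h₂ := types_congr_hom ((p i).naturality g.hom X) q
      refine h₁.trans (congrArg (N.action.nat.app X) (h₂.symm.trans ?_))
      exact congrArg (((p i).app N.monad).nat.app X) (funext hg)
    exact ⟨initialAction p hp X (((p i).app (initialMonad p)).nat.app X q),
      fun N => hcomm N (initialModelHom p hp N) fun j => hq j N, hcomm M f hf⟩
  | bind a h ih => exact ih

/-- `initialModel` is initial. -/
noncomputable def isInitialInitialModel : Limits.IsInitial (initialModel p hp) :=
  Limits.IsInitial.ofUniqueHom (initialModelHom p hp) fun M f => by
    refine Model.Hom.ext (MonadHom.ext' _ _ (funext fun X => ?_))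
    ext q
    obtain ⟨r, hr, hf⟩ := (initialProj_generated p q).exists_preimage p hp M f
    obtain rfl : r = q := initialObj_ext hr
    exact hf

end Initial

/-! ### Jointly epimorphic families of signatures -/

section Epi

variable {S : Signature.{u}}

/-- A family of subsets of the `S(R)(X)`, stable under all operations. -/
structure Subsignature (S : Signature.{u}) where
  mem (R : Monad (Type u)) (X : Type u) : Set ((S.obj R).obj X)
  map_mem {R : Monad (Type u)} {X Y : Type u} (f : X ⟶ Y) {x : (S.obj R).obj X} :
    x ∈ mem R X → (S.obj R).map f x ∈ mem R Y
  ρ_mem {R : Monad (Type u)} {X : Type u} {x : (S.obj R).obj (R.obj X)} :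
    x ∈ mem R (R.obj X) → (S.obj R).ρ.app X x ∈ mem R X
  hom_mem {R R' : Monad (Type u)} (f : R ⟶ R') {X : Type u} {x : (S.obj R).obj X} :
    x ∈ mem R X → (S.map f).nat.app X x ∈ mem R' X

/-- The type obtained from `A` by adding a point and collapsing `B` to it. -/
def Collapse {A : Type u} (B : Set A) : Type u :=
  Quot fun a b : Option A => (∃ x ∈ B, a = some x) ∧ b = none

namespace Collapse

variable {A A' : Type u} {B : Set A} {B' : Set A'}

/-- The image of an element. -/
def of (B : Set A) : A ⟶ Collapse B := ↾(fun x => Quot.mk _ (some x))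

/-- The added point. -/
def pt (B : Set A) : Collapse B := Quot.mk _ none

lemma of_eq_pt_iff (x : A) : of B x = pt B ↔ x ∈ B := by
  constructor
  · intro h
    -- Membership in `B`, extended by truth at the added point, respects the collapsing relation and
    -- so descends to the quotient.
    let φ : Collapse B → Prop := Quot.lift (fun a => ∀ x, a = some x → x ∈ B) (by
      rintro _ _ ⟨⟨x, hx, rfl⟩, rfl⟩
      simpa using hx)
    have h' : φ (of B x) = φ (pt B) := congrArg φ h
    have : φ (pt B) := fun y hy => by cases hy
    rw [← h'] at this
    exact this x rfl
  · exact fun h => Quot.sound ⟨⟨x, h, rfl⟩, rfl⟩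

lemma hom_ext {f g : Collapse B ⟶ A'} (h : of B ≫ f = of B ≫ g) (h' : f (pt B) = g (pt B)) :
    f = g := by
  ext x
  obtain ⟨_ | x⟩ := x
  · exact h'
  · exact types_congr_hom h x

/-- Functoriality of `Collapse`. -/
def map (f : A ⟶ A') (hf : ∀ x ∈ B, f x ∈ B') : Collapse B ⟶ Collapse B' :=
  ↾(Quot.map (Option.map f) (by
    rintro _ _ ⟨⟨x, hx, rfl⟩, rfl⟩
    exact ⟨⟨f x, hf x hx, rfl⟩, rfl⟩))

end Collapse

namespace Subsignature

variable (B : Subsignature S)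

/-- The signature obtained from `S` by adding a point and collapsing `B` to it. -/
def collapse : Signature.{u} where
  obj R :=
    { obj X := Collapse (B.mem R X)
      map f := Collapse.map ((S.obj R).map f) fun _ => B.map_mem f
      map_id X := Collapse.hom_ext (congrArg (· ≫ Collapse.of _) ((S.obj R).map_id X)) rfl
      map_comp f g := Collapse.hom_ext
        (congrArg (· ≫ Collapse.of _) ((S.obj R).map_comp f g)) rfl
      ρ :=
        { app X := Collapse.map ((S.obj R).ρ.app X) fun _ => B.ρ_mem
          naturality _ _ f := Collapse.hom_ext
            (congrArg (· ≫ Collapse.of _) ((S.obj R).ρ.naturality f)) rfl }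
      assoc X := Collapse.hom_ext (congrArg (· ≫ Collapse.of _) ((S.obj R).assoc X)) rfl
      unit X := Collapse.hom_ext (congrArg (· ≫ Collapse.of _) ((S.obj R).unit X)) rfl }
  map f :=
    { nat :=
        { app X := Collapse.map ((S.map f).nat.app X) fun _ => B.hom_mem f
          naturality _ _ g := Collapse.hom_ext
            (congrArg (· ≫ Collapse.of _) ((S.map f).nat.naturality g)) rfl }
      linear X := Collapse.hom_ext (congrArg (· ≫ Collapse.of _) ((S.map f).linear X)) rfl }
  map_id R X := Collapse.hom_ext (congrArg (· ≫ Collapse.of _) (S.map_id R X)) rfl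
  map_comp f g X := Collapse.hom_ext (congrArg (· ≫ Collapse.of _) (S.map_comp f g X)) rfl

/-- The quotient morphism. -/
def toCollapse : S ⟶ B.collapse where
  app R :=
    { nat :=
        { app X := Collapse.of (B.mem R X)
          naturality _ _ _ := rfl }
      linear _ := rfl }
  naturality _ _ := rfl

/-- The constant morphism. -/
def constCollapse : S ⟶ B.collapse where
  app R :=
    { nat :=
        { app X := ↾(fun _ => Collapse.pt (B.mem R X))
          naturality _ _ _ := rfl }
      linear _ := rfl }
  naturality _ _ := rfl

end Subsignature

/-- The joint image of a family of morphisms of signatures. -/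
def Subsignature.image {I : Type u} {T : I → Signature.{u}} (p : ∀ i, T i ⟶ S) :
    Subsignature S where
  mem R X := {x | ∃ i y, ((p i).app R).nat.app X y = x}
  map_mem {R X Y} f x := by
    rintro ⟨i, y, rfl⟩
    exact ⟨i, ((T i).obj R).map f y, NatTrans.naturality_apply ((p i).app R).nat f y⟩
  ρ_mem {R X x} := by
    rintro ⟨i, y, rfl⟩
    exact ⟨i, ((T i).obj R).ρ.app X y, types_congr_hom (((p i).app R).linear X) y⟩
  hom_mem {R R'} f X x := by
    rintro ⟨i, y, rfl⟩
    exact ⟨i, ((T i).map f).nat.app X y, types_congr_hom ((p i).naturality f X) y⟩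

/-- A jointly epimorphic family of morphisms of signatures is pointwise jointly surjective. -/
lemma exists_app_eq_of_jointly_epi {I : Type u} {T : I → Signature.{u}} (p : ∀ i, T i ⟶ S)
    (hp : ∀ {Z : Signature.{u}} (a b : S ⟶ Z), (∀ i, p i ≫ a = p i ≫ b) → a = b)
    (R : Monad (Type u)) (X : Type u) (x : (S.obj R).obj X) :
    ∃ i y, ((p i).app R).nat.app X y = x := by
  let B := Subsignature.image p
  have h : B.toCollapse = B.constCollapse := hp _ _ fun i => by
    refine Signature.Hom.ext (funext fun R => LMod.Hom.ext (NatTrans.ext (funext fun X => ?_)))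
    ext y
    exact (Collapse.of_eq_pt_iff (B := B.mem R X) _).2 ⟨i, y, rfl⟩
  have h' : Collapse.of (B.mem R X) x = Collapse.pt (B.mem R X) :=
    congrArg (fun a : S ⟶ B.collapse => (a.app R).nat.app X x) h
  exact (Collapse.of_eq_pt_iff x).1 h'

end Epi

end ModSig

/-- Any presentable signature is representable. -/
theorem theorem7p2 (S : ModSig.Signature.{u}) (hS : S.IsPresentable) : S.IsRepresentable := by
  obtain ⟨Y, q, ⟨I, s, ι, ⟨hι⟩⟩, hq⟩ := hS
  refine (ModSig.isInitialInitialModel (fun i => ι i ≫ q)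
    (ModSig.exists_app_eq_of_jointly_epi _ fun a b h => ?_)).hasInitial
  -- Joint epimorphy: `q` is cancellable, and morphisms out of the coproduct are determined on the
  -- injections.
  refine (cancel_epi q).1 (Limits.Cofan.IsColimit.hom_ext hι _ _ fun i => ?_)
  simpa using h i
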